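/- Let $d\ge 1$ and let $k(\mathbf x,\mathbf x')=\prod_{j=1}^d p_j(x_j\wedge x_j')\,q_j(x_j\vee x_j')$, $\mathbf x,\mathbf x'\in(0,1)^d$, be a tensor Markov (TM) kernel: $p_j,q_j>0$ on $(0,1)$ and $p_j/q_j$ is strictly increasing. Assume that, for each $j$, $p_j$ and $q_j$ are continuously differentiable and both solve $(u_jf')'+v_jf=0$ on $(0,1)$ for some $u_j\in C^1(0,1)$ and $v_j\in C(0,1)$. Notation. Let $\mathsf c_{l,i}=i2^{-l}$, and $\mathbf c_{\mathbf l,\mathbf i}=(\mathsf c_{l_1,i_1},\dots,\mathsf c_{l_d,i_d})$ for $\mathbf l\in\mathbb N^d$ (all $l_j\ge1$) and $\mathbf i$ with every $i_j$ odd and $1\le i_j\le 2^{l_j}-1$; all pairs $(\mathbf l,\mathbf i)$ below are of this kind. Let $\mathcal X_\tau=\bigcup_{|\mathbf l|\le\tau+d-1}\prod_{j}\{i2^{-l_j}:1\le i\le 2^{l_j}-1\}$, $|\mathbf l|=\sum_j l_j$, be the classical sparse grid of level $\tau$. A truncated sparse grid of size $n$ is a set $\mathcal X_\tau\cup\mathcal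 A$ with $\tau\ge1$, $|\mathcal X_\tau|\le n<|\mathcal X_{\tau+1}|$, $\mathcal A\subseteq\mathcal X_{\tau+1}\setminus\mathcal X_\tau$ and $|\mathcal A|=\tilde n:=n-|\mathcal X_\tau|$. Put $\mathsf p_{j,l,i}=p_j(\mathsf c_{l,i})$ and $\mathsf q_{j,l,i}=q_j(\mathsf c_{l,i})$ for $1\le i\le 2^l-1$, with the boundary convention $\mathsf p_{j,l,0}=\mathsf q_{j,l,2^l}=0$, $\mathsf p_{j,l,2^l}=\mathsf q_{j,l,0}=1$. Let $\phi_{\mathbf l,\mathbf i}(\mathbf x)=\prod_j\phi_{j,l_j,i_j}(x_j)$, where $$\phi_{j,l,i}(x)=\frac{p_j(x)\mathsf q_{j,l,i-1}-\mathsf p_{j,l,i-1}q_j(x)}{\mathsf p_{j,l,i}\mathsf q_{j,l,i-1}-\mathsf p_{j,l,i-1}\mathsf q_{j,l,i}}\ \text{ on }(\mathsf c_{l,i-1},\mathsf c_{l,i}],\qquad \phi_{j,l,i}(x)=\frac{\mathsf p_{j,l,i+1}q_j(x)-p_j(x)\mathsf q_{j,l,i+1}}{\mathsf p_{j,l,i+1}\mathsf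 q_{j,l,i}-\mathsf p_{j,l,i}\mathsf q_{j,l,i+1}}\ \text{ on }(\mathsf c_{l,i},\mathsf c_{l,i+1}),$$ and $\phi_{j,l,i}=0$ elsewhere. Let $\mathcal R_{\mathbf l,\mathbf i}=\prod_j(\mathsf c_{l_j,i_j-1},\mathsf c_{l_j,i_j+1})$. Theorem. There is a constant $C$ that does not depend on $n,\tau,\mathcal A$ such that the following holds for every truncated sparse grid $\mathcal X_\tau\cup\mathcal A$ of size $n\ge3$ with kernel matrix $\mathbf K=k(\mathcal X_\tau\cup\mathcal A,\mathcal X_\tau\cup\mathcal A)$. (i) $\mathbf A=k(\mathcal X_\tau,\mathcal X_\tau)$ and $\mathbf K$ are invertible, and $$\mathbf K^{-1}=\begin{pmatrix}\mathbf E&-\mathbf B\mathbf D\\-\mathbf D\mathbf B^{\intercal}&\mathbf D\end{pmatrix},\qquad \mathbf B=\mathbf A^{-1}k(\mathcal X_\tau,\mathcal A),\quad \mathbf E=\mathbf A^{-1}+\mathbf B\mathbf D\mathbf B^{\intercal},$$ with blocks of sizes $|\mathcal X_\tau|$ and $\tilde n$, where $\mathbf D$ is diagonal and, for all $(\mathbf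 l,\mathbf i)$ with $\mathbf c_{\mathbf l,\mathbf i}\in\mathcal A$, $$\mathbf D_{(\mathbf l,\mathbf i),(\mathbf l,\mathbf i)}=\prod_{j=1}^d\frac{\mathsf p_{j,l_j,i_j+1}\mathsf q_{j,l_j,i_j-1}-\mathsf p_{j,l_j,i_j-1}\mathsf q_{j,l_j,i_j+1}}{(\mathsf p_{j,l_j,i_j}\mathsf q_{j,l_j,i_j-1}-\mathsf p_{j,l_j,i_j-1}\mathsf q_{j,l_j,i_j})(\mathsf p_{j,l_j,i_j+1}\mathsf q_{j,l_j,i_j}-\mathsf p_{j,l_j,i_j}\mathsf q_{j,l_j,i_j+1})}=\|\phi_{\mathbf l,\mathbf i}\|_{\mathscr H_k}^2,$$ where $\mathscr H_k$ is the reproducing kernel Hilbert space of $k$ on $(0,1)^d$, which contains $\phi_{\mathbf l,\mathbf i}$. (ii) $(\mathbf K^{-1})_{(\mathbf l',\mathbf i'),(\mathbf l'',\mathbf i'')}=(\mathbf K^{-1})_{(\mathbf l'',\mathbf i''),(\mathbf l',\mathbf i')}=0$ whenever one of the following holds: (a) $\mathbf c_{\mathbf l',\mathbf i'},\mathbf c_{\mathbf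 l'',\mathbf i''}\in\mathcal A$ and $\mathbf c_{\mathbf l',\mathbf i'}\ne\mathbf c_{\mathbf l'',\mathbf i''}$; (b) $\mathbf c_{\mathbf l',\mathbf i'}\in\mathcal X_\tau$, $\mathbf c_{\mathbf l'',\mathbf i''}\in\mathcal A$ and $\mathbf c_{\mathbf l'',\mathbf i''}\notin\mathcal R_{\mathbf l',\mathbf i'}$; (c) $\mathbf c_{\mathbf l',\mathbf i'},\mathbf c_{\mathbf l'',\mathbf i''}\in\mathcal X_\tau$, $\bigl|i_j'2^{l_j'\vee l_j''-l_j'}-i_j''2^{l_j'\vee l_j''-l_j''}\bigr|\ge2$ for some $j$, and no point of $\mathcal A$ lies in $\mathcal R_{\mathbf l',\mathbf i'}\cap\mathcal R_{\mathbf l'',\mathbf i''}$. (iii) The number of nonzero entries of $\mathbf E$ is at most $C(|\mathcal X_\tau|+\tilde n\tau^{2d})$; if $\tau\ge2$, that of $\mathbf B\mathbf D$ is at most $C\,\tilde n\,(\log|\mathcal X_\tau|)^{d-1}$; and the proportion of nonzero entries of $\mathbf K^{-1}$ is at most $C\,n^{-1}(\log n)^{2d}$. -/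

import Mathlib

noncomputable section

/-! ### Tensor Markov kernels on the open unit cube -/

/-- `p`, `q` are the factors of a tensor Markov kernel on `(0,1)^d`: positive functions on `(0,1)`
with `p j / q j` strictly increasing. -/
structure IsTMPair {d : ℕ} (p q : Fin d → ℝ → ℝ) : Prop where
  p_pos : ∀ j, ∀ x ∈ Set.Ioo (0 : ℝ) 1, 0 < p j x
  q_pos : ∀ j, ∀ x ∈ Set.Ioo (0 : ℝ) 1, 0 < q j x
  ratio_strictMono : ∀ j, StrictMonoOn (fun x => p j x / q j x) (Set.Ioo (0 : ℝ) 1)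

/-- `f` solves `(u f')' + v f = 0` on `(0,1)`. -/
def SolvesSL (u v f : ℝ → ℝ) : Prop :=
  ∀ x ∈ Set.Ioo (0 : ℝ) 1, HasDerivAt (fun y => u y * deriv f y) (-(v x * f x)) x

/-- For each coordinate, `p j` and `q j` are continuously differentiable on `(0,1)` and solve a
common Sturm–Liouville equation with `u` continuously differentiable and `v` continuous. -/
def SatisfiesSL {d : ℕ} (p q : Fin d → ℝ → ℝ) : Prop :=
  ∀ j, ContDiffOn ℝ 1 (p j) (Set.Ioo (0 : ℝ) 1) ∧ ContDiffOn ℝ 1 (q j) (Set.Ioo (0 : ℝ) 1) ∧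
    ∃ u v : ℝ → ℝ, ContDiffOn ℝ 1 u (Set.Ioo (0 : ℝ) 1) ∧ ContinuousOn v (Set.Ioo (0 : ℝ) 1) ∧
      SolvesSL u v (p j) ∧ SolvesSL u v (q j)

/-- `k(x,y) = ∏ⱼ pⱼ(xⱼ ∧ yⱼ) qⱼ(xⱼ ∨ yⱼ)`. -/
def tmKernel {d : ℕ} (p q : Fin d → ℝ → ℝ) (x y : Fin d → ℝ) : ℝ :=
  ∏ j, p j (min (x j) (y j)) * q j (max (x j) (y j))

/-- The matrix `k(S, T)` of kernel values for two finite sets of points. -/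
def kernelMatrix {d : ℕ} (p q : Fin d → ℝ → ℝ) (S T : Finset (Fin d → ℝ)) : Matrix S T ℝ :=
  Matrix.of fun x y => tmKernel p q x y

/-! ### Sparse grids -/

/-- The dyadic node `i · 2^{-l}`. -/
def node (l i : ℕ) : ℝ := (i : ℝ) / 2 ^ l

/-- The one-dimensional dyadic design `{i · 2^{-l} : 1 ≤ i ≤ 2^l - 1}`. -/
def dyadicGrid (l : ℕ) : Finset ℝ := (Finset.Icc 1 (2 ^ l - 1)).image (node l)

/-- The classical sparse grid of level `τ`: the union of the lattices with levels
`l j ≥ 1` and `∑ j, l j ≤ τ + d - 1`. -/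
def sparseGrid (d τ : ℕ) : Finset (Fin d → ℝ) :=
  ((Fintype.piFinset fun _ : Fin d => Finset.Icc 1 (τ + d - 1)).filter
    fun l => ∑ j, l j ≤ τ + d - 1).biUnion
      fun l => Fintype.piFinset fun j => dyadicGrid (l j)

/-- `sparseGrid d τ ∪ A` is a truncated sparse grid of size `n`. -/
structure IsTSG {d : ℕ} (n τ : ℕ) (A : Finset (Fin d → ℝ)) : Prop where
  one_le_level : 1 ≤ τ
  card_le : (sparseGrid d τ).card ≤ n
  lt_card : n < (sparseGrid d (τ + 1)).card
  subset : A ⊆ sparseGrid d (τ + 1) \ sparseGrid d τ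
  card_add : (sparseGrid d τ).card + A.card = n

theorem IsTSG.disjoint {d n τ : ℕ} {A : Finset (Fin d → ℝ)} (h : IsTSG n τ A) :
    Disjoint (sparseGrid d τ) A :=
  Finset.disjoint_of_subset_right h.subset Finset.disjoint_sdiff

/-- Admissible indices for the level `l`: every `i j` is odd and lies between `1` and `2^{l j}`.
Since every odd number is at least `1`, this forces `l j ≥ 1`. -/
def IsIndex {d : ℕ} (l i : Fin d → ℕ) : Prop := ∀ j, Odd (i j) ∧ i j < 2 ^ l j

/-- The grid point with level `l` and index `i`. -/
def gridPoint {d : ℕ} (l i : Fin d → ℕ) : Fin d → ℝ := fun j => node (l j) (i j)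

/-- The open hyperrectangle `∏ⱼ ((i j - 1) 2^{-l j}, (i j + 1) 2^{-l j})`. -/
def hyperrect {d : ℕ} (l i : Fin d → ℕ) : Set (Fin d → ℝ) :=
  {x | ∀ j, x j ∈ Set.Ioo (node (l j) (i j - 1)) (node (l j) (i j + 1))}

/-! ### Basis functions -/

/-- Nodal values of `p` at level `l`. At the end points `0` and `1` of the design interval, where
the kernel is not defined, the values are `0` and `1`. -/
def pNode (p : ℝ → ℝ) (l i : ℕ) : ℝ := if i = 0 then 0 else if i = 2 ^ l then 1 else p (node l i)

/-- Nodal values of `q` at level `l`, with the values `1` and `0` at the end points. -/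
def qNode (q : ℝ → ℝ) (l i : ℕ) : ℝ := if i = 0 then 1 else if i = 2 ^ l then 0 else q (node l i)

/-- The quotient
`(p_{i+1} q_{i-1} - p_{i-1} q_{i+1}) / ((p_i q_{i-1} - p_{i-1} q_i) (p_{i+1} q_i - p_i q_{i+1}))`
of nodal values at level `l`. -/
def nodeRatio (p q : ℝ → ℝ) (l i : ℕ) : ℝ :=
  (pNode p l (i + 1) * qNode q l (i - 1) - pNode p l (i - 1) * qNode q l (i + 1)) /
    ((pNode p l i * qNode q l (i - 1) - pNode p l (i - 1) * qNode q l i) *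
      (pNode p l (i + 1) * qNode q l i - pNode p l i * qNode q l (i + 1)))

/-- The one-dimensional basis function with support around the node `i · 2^{-l}`. -/
def basisFun1 (p q : ℝ → ℝ) (l i : ℕ) (x : ℝ) : ℝ :=
  if x ∈ Set.Ioc (node l (i - 1)) (node l i) then
    (p x * qNode q l (i - 1) - pNode p l (i - 1) * q x) /
      (pNode p l i * qNode q l (i - 1) - pNode p l (i - 1) * qNode q l i)
  else if x ∈ Set.Ioo (node l i) (node l (i + 1)) then
    (pNode p l (i + 1) * q x - p x * qNode q l (i + 1)) /
      (pNode p l (i + 1) * qNode q l i - pNode p l i * qNode q l (i + 1))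
  else 0

/-- The tensor product basis function. -/
def basisFun {d : ℕ} (p q : Fin d → ℝ → ℝ) (l i : Fin d → ℕ) (x : Fin d → ℝ) : ℝ :=
  ∏ j, basisFun1 (p j) (q j) (l j) (i j) (x j)

/-- The open unit cube `(0,1)^d`. -/
abbrev UnitCube (d : ℕ) : Type := {x : Fin d → ℝ // ∀ j, x j ∈ Set.Ioo (0 : ℝ) 1}

/-- `H` is the reproducing kernel Hilbert space of the kernel on `(0,1)^d`. -/
def HasTMKernel {d : ℕ} (p q : Fin d → ℝ → ℝ) (H : Type*) [NormedAddCommGroup H]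
    [InnerProductSpace ℝ H] [CompleteSpace H] [RKHS ℝ H (UnitCube d) ℝ] : Prop :=
  ∀ x y : UnitCube d, RKHS.kernel H x y 1 = tmKernel p q x.1 y.1

/-! ### Counting nonzero entries -/

/-- The number of nonzero entries of a matrix. -/
def nnz {m n : Type*} [Fintype m] [Fintype n] (M : Matrix m n ℝ) : ℕ :=
  (Finset.univ.filter fun ij : m × n => M ij.1 ij.2 ≠ 0).card

/-- The proportion of nonzero entries of a matrix. -/
def density {m n : Type*} [Fintype m] [Fintype n] (M : Matrix m n ℝ) : ℝ :=
  (nnz M : ℝ) / ((Fintype.card m : ℝ) * (Fintype.card n : ℝ))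

end

/-! ### Dyadic nodes -/

/-! Each basis function is a finite combination of kernel functions: its coefficients `coef` sit on
the at most 3^d points whose coordinates are the node or one of its two neighbours at that level
(`sum_coef1_mul_kernel1`). By the reproducing property, the inner product of two basis functions is
a weighted sum of values of one over the stencil of the other. In one coordinate the function of
finer level, having odd index, vanishes at all coarser nodes, so distinct basis functions are
orthogonal (`gram1_eq`); the Gram matrix tensorises.

Let X be a finite design containing the stencil of each of its points, Φ the coefficient matrix
`hierMatrix` and W the diagonal matrix of squared norms. Orthogonality reads Φ K Φᵀ = W, hence K⁻¹ =
Φᵀ W⁻¹ Φ. An entry at (y, z) can be nonzero only if y and z lie in a common stencil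
(`IsHierarchical.exists_mem_stencil`).

The stencil of a point of the sparse grid of level τ+1 lies, except for the point itself, in the
grid of level τ (`mem_sparseGrid_of_mem_nbrs`). So X_τ ∪ A is such a design for every A, and a point
of A lies in no stencil but its own: its column of K⁻¹ is its own coefficient vector. This makes D
diagonal with entries the squared norms; block elimination gives E and B D. The zero pattern reduces
to the geometry of stencils. Since one stencil yields at most 9^d pairs, the number of nonzero
entries is linear in n, and the powers of τ and of the logarithms only have to be at least 1. -/

theorem node_lt_node {l i j : ℕ} : node l i < node l j ↔ i < j := by
  unfold node
  rw [div_lt_div_iff_of_pos_right (by positivity)]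
  exact_mod_cast Iff.rfl

theorem node_le_node {l i j : ℕ} : node l i ≤ node l j ↔ i ≤ j := by
  unfold node
  rw [div_le_div_iff_of_pos_right (by positivity)]
  exact_mod_cast Iff.rfl

theorem node_inj {l i j : ℕ} : node l i = node l j ↔ i = j := by
  rw [le_antisymm_iff, node_le_node, node_le_node, le_antisymm_iff]

theorem node_zero (l : ℕ) : node l 0 = 0 := by simp [node]

theorem node_two_pow (l : ℕ) : node l (2 ^ l) = 1 := by simp [node]

theorem node_mem_Ioo {l i : ℕ} : node l i ∈ Set.Ioo (0 : ℝ) 1 ↔ 0 < i ∧ i < 2 ^ l := by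
  rw [Set.mem_Ioo, ← node_zero l, ← node_two_pow l, node_lt_node, node_lt_node]

theorem node_add_mul_two_pow (l k i : ℕ) : node (l + k) (i * 2 ^ k) = node l i := by
  unfold node
  push_cast
  rw [pow_add]
  field_simp

theorem mem_dyadicGrid {l : ℕ} {x : ℝ} :
    x ∈ dyadicGrid l ↔ ∃ i, 0 < i ∧ i < 2 ^ l ∧ node l i = x := by
  unfold dyadicGrid
  simp only [Finset.mem_image, Finset.mem_Icc]
  have := Nat.two_pow_pos l
  constructor
  · rintro ⟨i, hi, rfl⟩
    exact ⟨i, by omega, by omega, rfl⟩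
  · rintro ⟨i, h1, h2, rfl⟩
    exact ⟨i, by omega, rfl⟩

theorem mem_Ioo_of_mem_dyadicGrid {l : ℕ} {x : ℝ} (h : x ∈ dyadicGrid l) :
    x ∈ Set.Ioo (0 : ℝ) 1 := by
  obtain ⟨i, h1, h2, rfl⟩ := mem_dyadicGrid.1 h
  exact node_mem_Ioo.2 ⟨h1, h2⟩

theorem exists_odd_of_mem_dyadicGrid {m : ℕ} {x : ℝ} (h : x ∈ dyadicGrid m) :
    ∃ l i, l ≤ m ∧ Odd i ∧ i < 2 ^ l ∧ node l i = x := by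
  obtain ⟨i, h1, h2, rfl⟩ := mem_dyadicGrid.1 h
  obtain ⟨k, i', hodd, rfl⟩ := Nat.exists_eq_two_pow_mul_odd h1.ne'
  have hk : k ≤ m := by
    by_contra! hlt
    have : 2 ^ m ≤ 2 ^ k := Nat.pow_le_pow_right (by norm_num) hlt.le
    nlinarith [hodd.pos]
  obtain ⟨l, rfl⟩ := Nat.exists_eq_add_of_le' hk
  refine ⟨l, i', by omega, hodd, ?_, ?_⟩
  · rw [pow_add, mul_comm] at h2
    exact Nat.lt_of_mul_lt_mul_right h2
  · rw [mul_comm, node_add_mul_two_pow]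

/-- An odd numerator means that the dyadic fraction is reduced, so every other representation has at
least its denominator. -/
theorem le_of_node_eq_node {l i m j : ℕ} (hi : Odd i) (h : node l i = node m j) : l ≤ m := by
  by_contra! hlt
  obtain ⟨k, rfl⟩ := Nat.exists_eq_add_of_le hlt.le
  rw [← node_add_mul_two_pow m k j, node_inj] at h
  subst h
  have hk : k ≠ 0 := by omega
  have : Even (j * 2 ^ k) := ((Nat.even_pow.2 ⟨even_two, hk⟩)).mul_left j
  exact (Nat.not_even_iff_odd.2 hi) this

theorem odd_node_inj {l i m j : ℕ} (hi : Odd i) (hj : Odd j) (h : node l i = node m j) :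
    l = m ∧ i = j := by
  obtain rfl := le_antisymm (le_of_node_eq_node hi h) (le_of_node_eq_node hj h.symm)
  exact ⟨rfl, node_inj.1 h⟩

theorem le_of_odd_node_mem_dyadicGrid {l i m : ℕ} (hi : Odd i) (h : node l i ∈ dyadicGrid m) :
    l ≤ m := by
  obtain ⟨j, -, -, hj⟩ := mem_dyadicGrid.1 h
  exact le_of_node_eq_node hi hj.symm

/-- The node `i · 2^{-l}` together with its two neighbours, inside `(0,1)`. -/
noncomputable def nbr (l i : ℕ) : Finset ℝ :=
  (({i - 1, i, i + 1} : Finset ℕ).filter fun m => 0 < m ∧ m < 2 ^ l).image (node l)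

theorem mem_nbr {l i : ℕ} {x : ℝ} :
    x ∈ nbr l i ↔ ∃ m, (m = i - 1 ∨ m = i ∨ m = i + 1) ∧ 0 < m ∧ m < 2 ^ l ∧ node l m = x := by
  unfold nbr
  simp only [Finset.mem_image, Finset.mem_filter, Finset.mem_insert, Finset.mem_singleton]
  constructor
  · rintro ⟨m, ⟨h, h1, h2⟩, h3⟩
    exact ⟨m, h, h1, h2, h3⟩
  · rintro ⟨m, h, h1, h2, h3⟩
    exact ⟨m, ⟨h, h1, h2⟩, h3⟩

theorem card_nbr_le (l i : ℕ) : (nbr l i).card ≤ 3 :=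
  Finset.card_image_le.trans ((Finset.card_filter_le _ _).trans Finset.card_le_three)

theorem nbr_subset_dyadicGrid (l i : ℕ) : nbr l i ⊆ dyadicGrid l := by
  intro x hx
  obtain ⟨m, -, h1, h2, h3⟩ := mem_nbr.1 hx
  exact mem_dyadicGrid.2 ⟨m, h1, h2, h3⟩

theorem self_mem_nbr {l i : ℕ} (h0 : 0 < i) (h1 : i < 2 ^ l) : node l i ∈ nbr l i :=
  mem_nbr.2 ⟨i, by simp, h0, h1, rfl⟩

/-- The neighbours of an odd node belong to the next coarser grid. -/
theorem eq_or_mem_dyadicGrid_of_mem_nbr {l i : ℕ} (hi : Odd i) {x : ℝ} (hx : x ∈ nbr l i) :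
    x = node l i ∨ ∃ m, l = m + 1 ∧ x ∈ dyadicGrid m := by
  obtain ⟨m, h, h1, h2, rfl⟩ := mem_nbr.1 hx
  by_cases hm : m = i
  · exact Or.inl (by rw [hm])
  · right
    have hev : ∃ k, m = k * 2 := by
      obtain ⟨r, rfl⟩ := hi
      rcases h with h | h | h
      · exact ⟨r, by omega⟩
      · exact absurd h hm
      · exact ⟨r + 1, by omega⟩
    obtain ⟨k, rfl⟩ := hev
    cases l with
    | zero => simp at h2; omega
    | succ l =>
      refine ⟨l, rfl, mem_dyadicGrid.2 ⟨k, by omega, ?_, ?_⟩⟩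
      · rw [pow_succ] at h2; omega
      · have := node_add_mul_two_pow l 1 k
        rw [pow_one] at this
        exact this.symm

theorem abs_sub_le_of_mem_nbr {l i : ℕ} {x : ℝ} (hx : x ∈ nbr l i) :
    |x - node l i| ≤ 1 / 2 ^ l := by
  obtain ⟨m, h, h1, h2, rfl⟩ := mem_nbr.1 hx
  have : node l m - node l i = ((m : ℝ) - i) / 2 ^ l := by unfold node; ring
  rw [this, abs_div, abs_of_pos (by positivity : (0 : ℝ) < 2 ^ l)]
  gcongr
  rw [abs_le]
  have h3 : (m : ℝ) ≤ i + 1 := by exact_mod_cast (by omega : m ≤ i + 1)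
  have h4 : (i : ℝ) ≤ m + 1 := by exact_mod_cast (by omega : i ≤ m + 1)
  constructor <;> linarith

/-! ### One-dimensional Markov kernels -/

/-- The factor `p (s ∧ t) q (s ∨ t)` of a tensor Markov kernel. -/
noncomputable def kernel1 (p q : ℝ → ℝ) (s t : ℝ) : ℝ := p (min s t) * q (max s t)

theorem kernel1_comm (p q : ℝ → ℝ) (s t : ℝ) : kernel1 p q s t = kernel1 p q t s := by
  unfold kernel1
  rw [min_comm, max_comm]

/-- The `2 × 2` determinant `p_j q_i - p_i q_j` of nodal values. -/
noncomputable def nodeDet (p q : ℝ → ℝ) (l i j : ℕ) : ℝ :=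
  pNode p l j * qNode q l i - pNode p l i * qNode q l j

/-- The coefficients of the basis function in the kernel functions at the neighbouring nodes. -/
noncomputable def coef1 (p q : ℝ → ℝ) (l i : ℕ) (y : ℝ) : ℝ :=
  if y = node l i then nodeRatio p q l i
  else if y = node l (i - 1) then -(nodeDet p q l (i - 1) i)⁻¹
  else if y = node l (i + 1) then -(nodeDet p q l i (i + 1))⁻¹
  else 0

/-- The kernel function at a node, extended to the end points of `[0,1]`. -/
noncomputable def nodeKernel (p q : ℝ → ℝ) (l m : ℕ) (s : ℝ) : ℝ :=
  if node l m ≤ s then pNode p l m * q s else p s * qNode q l m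

section OneDim

variable {p q : ℝ → ℝ}

theorem pNode_of_mem {l i : ℕ} (h0 : 0 < i) (h1 : i < 2 ^ l) : pNode p l i = p (node l i) := by
  unfold pNode
  rw [if_neg h0.ne', if_neg h1.ne]

theorem qNode_of_mem {l i : ℕ} (h0 : 0 < i) (h1 : i < 2 ^ l) : qNode q l i = q (node l i) := by
  unfold qNode
  rw [if_neg h0.ne', if_neg h1.ne]

theorem nodeKernel_of_mem {l m : ℕ} (h0 : 0 < m) (h1 : m < 2 ^ l) (s : ℝ) :
    nodeKernel p q l m s = kernel1 p q (node l m) s := by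
  unfold nodeKernel kernel1
  rw [pNode_of_mem h0 h1, qNode_of_mem h0 h1]
  split_ifs with h
  · rw [min_eq_left h, max_eq_right h]
  · rw [min_eq_right (not_le.1 h).le, max_eq_left (not_le.1 h).le]

/-- The boundary convention makes the kernel functions at 0 and 1 vanish, which is why `nbr` may
drop the end points. -/
theorem nodeKernel_zero {l : ℕ} {s : ℝ} (hs : s ∈ Set.Ioo (0 : ℝ) 1) :
    nodeKernel p q l 0 s = 0 := by
  simp [nodeKernel, node_zero, hs.1.le, pNode]

theorem nodeKernel_two_pow {l : ℕ} {s : ℝ} (hs : s ∈ Set.Ioo (0 : ℝ) 1) :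
    nodeKernel p q l (2 ^ l) s = 0 := by
  simp [nodeKernel, node_two_pow, not_le.2 hs.2, qNode]

theorem coef1_self (l i : ℕ) : coef1 p q l i (node l i) = nodeRatio p q l i := if_pos rfl

theorem coef1_pred {l i : ℕ} (h : 0 < i) :
    coef1 p q l i (node l (i - 1)) = -(nodeDet p q l (i - 1) i)⁻¹ := by
  unfold coef1
  rw [if_neg (by rw [node_inj]; omega), if_pos rfl]

theorem coef1_succ {l i : ℕ} :
    coef1 p q l i (node l (i + 1)) = -(nodeDet p q l i (i + 1))⁻¹ := by
  unfold coef1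
  rw [if_neg (by rw [node_inj]; omega), if_neg (by rw [node_inj]; omega), if_pos rfl]

theorem coef1_eq_zero {l i : ℕ} {y : ℝ} (hy : y ∈ Set.Ioo (0 : ℝ) 1) (h : y ∉ nbr l i) :
    coef1 p q l i y = 0 := by
  have key : ∀ m, (m = i - 1 ∨ m = i ∨ m = i + 1) → y ≠ node l m := by
    rintro m hm rfl
    rw [node_mem_Ioo] at hy
    exact h (mem_nbr.2 ⟨m, hm, hy.1, hy.2, rfl⟩)
  unfold coef1
  rw [if_neg (key _ (by simp)), if_neg (key _ (by simp)), if_neg (key _ (by simp))]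

/-- Restores a uniform three-term sum: a neighbour missing from `nbr` is an end point, where `g` is
zero. -/
theorem sum_nbr {l i : ℕ} (h0 : 0 < i) {f : ℝ → ℝ} {g : ℕ → ℝ}
    (hg : ∀ m, 0 < m → m < 2 ^ l → f (node l m) = g m) (hg0 : g 0 = 0) (hg1 : g (2 ^ l) = 0)
    (h1 : i < 2 ^ l) :
    ∑ t ∈ nbr l i, f t = g (i - 1) + g i + g (i + 1) := by
  unfold nbr
  rw [Finset.sum_image (fun a _ b _ h => node_inj.1 h),
    Finset.sum_congr rfl fun m hm => hg m (Finset.mem_filter.1 hm).2.1 (Finset.mem_filter.1 hm).2.2,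
    Finset.sum_filter_of_ne, Finset.sum_insert, Finset.sum_insert, Finset.sum_singleton, add_assoc]
  · simp
  · simp; omega
  · intro m hm hne
    simp only [Finset.mem_insert, Finset.mem_singleton] at hm
    have h2 : m ≠ 0 := fun h => hne (h ▸ hg0)
    have h3 : m ≠ 2 ^ l := fun h => hne (h ▸ hg1)
    omega

variable (hp : ∀ x ∈ Set.Ioo (0 : ℝ) 1, 0 < p x) (hq : ∀ x ∈ Set.Ioo (0 : ℝ) 1, 0 < q x)
  (hr : StrictMonoOn (fun x => p x / q x) (Set.Ioo (0 : ℝ) 1))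

include hp hq hr in
-- Strict growth of p/q, cross-multiplied; at an end point the convention reduces the determinant to
-- a value of p or q, or to 1.
theorem nodeDet_pos {l i j : ℕ} (hij : i < j) (hj : j ≤ 2 ^ l) : 0 < nodeDet p q l i j := by
  unfold nodeDet
  have hj0 : j ≠ 0 := by omega
  have hi1 : i ≠ 2 ^ l := by omega
  by_cases hi0 : i = 0 <;> by_cases hj1 : j = 2 ^ l
  · simp [hi0, hj1, pNode, qNode]
  · have := hp _ (node_mem_Ioo.2 ⟨by omega, by omega⟩ : node l j ∈ _)
    simpa [hi0, hj1, hj0, pNode, qNode] using this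
  · have := hq _ (node_mem_Ioo.2 ⟨by omega, by omega⟩ : node l i ∈ _)
    simpa [hi0, hj1, hi1, pNode, qNode] using this
  · have hi : node l i ∈ Set.Ioo (0 : ℝ) 1 := node_mem_Ioo.2 ⟨by omega, by omega⟩
    have hj' : node l j ∈ Set.Ioo (0 : ℝ) 1 := node_mem_Ioo.2 ⟨by omega, by omega⟩
    have := hr hi hj' (node_lt_node.2 hij)
    simp only at this
    rw [div_lt_div_iff₀ (hq _ hi) (hq _ hj')] at this
    rw [pNode_of_mem (by omega) (by omega), pNode_of_mem (by omega) (by omega),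
      qNode_of_mem (by omega) (by omega), qNode_of_mem (by omega) (by omega)]
    linarith

theorem nodeRatio_eq (l i : ℕ) : nodeRatio p q l i =
    nodeDet p q l (i - 1) (i + 1) / (nodeDet p q l (i - 1) i * nodeDet p q l i (i + 1)) := rfl

include hp hq hr in
theorem nodeRatio_pos {l i : ℕ} (h0 : 0 < i) (h1 : i < 2 ^ l) : 0 < nodeRatio p q l i := by
  rw [nodeRatio_eq]
  exact div_pos (nodeDet_pos hp hq hr (by omega) (by omega))
    (mul_pos (nodeDet_pos hp hq hr (by omega) (by omega))
      (nodeDet_pos hp hq hr (by omega) (by omega)))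

include hp hq hr in
/-- The basis function is a combination of the kernel functions at the neighbouring nodes. -/
theorem sum_coef1_mul_kernel1 {l i : ℕ} (h0 : 0 < i) (h1 : i < 2 ^ l) {s : ℝ}
    (hs : s ∈ Set.Ioo (0 : ℝ) 1) :
    ∑ t ∈ nbr l i, coef1 p q l i t * kernel1 p q t s = basisFun1 p q l i s := by
  rw [sum_nbr (g := fun m => coef1 p q l i (node l m) * nodeKernel p q l m s) h0
    (fun m hm0 hm1 => by rw [nodeKernel_of_mem hm0 hm1])
    (by simp [nodeKernel_zero hs]) (by simp [nodeKernel_two_pow hs]) h1]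
  have d1 := nodeDet_pos hp hq hr (show i - 1 < i by omega) (show i ≤ 2 ^ l by omega)
  have d2 := nodeDet_pos hp hq hr (show i < i + 1 by omega) (show i + 1 ≤ 2 ^ l by omega)
  have n1 : node l (i - 1) < node l i := node_lt_node.2 (by omega)
  have n2 : node l i < node l (i + 1) := node_lt_node.2 (by omega)
  have ea : s = node l (i - 1) → p s * qNode q l (i - 1) = pNode p l (i - 1) * q s := by
    rintro rfl
    rw [node_mem_Ioo] at hs
    rw [pNode_of_mem hs.1 hs.2, qNode_of_mem hs.1 hs.2]
  have eb : s = node l i → p s = pNode p l i ∧ q s = qNode q l i := by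
    rintro rfl
    rw [pNode_of_mem h0 h1, qNode_of_mem h0 h1]
    exact ⟨rfl, rfl⟩
  simp only [coef1_self, coef1_pred h0, coef1_succ, nodeRatio_eq]
  unfold basisFun1 nodeKernel
  change _ = if _ then _ / nodeDet p q l (i - 1) i else if _ then _ / nodeDet p q l i (i + 1) else _
  have i1 := mul_inv_cancel₀ d1.ne'
  have i2 := mul_inv_cancel₀ d2.ne'
  -- `r1` and `r2` are the three-term relation between the 2 × 2 determinants of the vectors (p, q)
  -- at three consecutive nodes.
  have r1 : nodeDet p q l (i - 1) (i + 1) * qNode q l i =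
      qNode q l (i - 1) * nodeDet p q l i (i + 1) + qNode q l (i + 1) * nodeDet p q l (i - 1) i := by
    unfold nodeDet; ring
  have r2 : nodeDet p q l (i - 1) (i + 1) * pNode p l i =
      pNode p l (i - 1) * nodeDet p q l i (i + 1) + pNode p l (i + 1) * nodeDet p q l (i - 1) i := by
    unfold nodeDet; ring
  have r3 : nodeDet p q l (i - 1) i =
    pNode p l i * qNode q l (i - 1) - pNode p l (i - 1) * qNode q l i := rfl
  simp only [div_eq_mul_inv, mul_inv]
  generalize nodeDet p q l (i - 1) (i + 1) = N at *
  generalize nodeDet p q l (i - 1) i = D at *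
  generalize nodeDet p q l i (i + 1) = D' at *
  generalize pNode p l (i - 1) = pa at *
  generalize pNode p l i = pb at *
  generalize pNode p l (i + 1) = pc at *
  generalize qNode q l (i - 1) = qa at *
  generalize qNode q l i = qb at *
  generalize qNode q l (i + 1) = qc at *
  generalize node l (i - 1) = a at *
  generalize node l i = b at *
  generalize node l (i + 1) = c at *
  generalize D⁻¹ = e at *
  generalize D'⁻¹ = e' at *
  -- `w1` and `w2` say that the three coefficients annihilate the nodal values of q and of p. This
  -- gives zero outside the support and, inside it, eliminates one of the outer terms.
  have w1 : N * (e * e') * qb = qa * e + qc * e' := by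
    linear_combination e * e' * r1 + qa * e * i2 + qc * e' * i1
  have w2 : N * (e * e') * pb = pa * e + pc * e' := by
    linear_combination e * e' * r2 + pa * e * i2 + pc * e' * i1
  simp only [Set.mem_Ioc, Set.mem_Ioo]
  rcases lt_or_ge s a with ha | ha
  · rw [if_neg (by linarith), if_neg (by linarith), if_neg (by linarith),
      if_neg (by rintro ⟨_, _⟩; linarith), if_neg (by rintro ⟨_, _⟩; linarith)]
    linear_combination p s * w1
  rcases lt_or_ge s b with hb | hb
  · rw [if_pos ha, if_neg (by linarith), if_neg (by linarith)]
    -- The left end point is outside the half-open support but on the left branch of the formula;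
    -- `ea` shows that this branch vanishes there.
    rcases ha.eq_or_lt with ha | ha
    · rw [if_neg (by rintro ⟨_, _⟩; linarith), if_neg (by rintro ⟨_, _⟩; linarith)]
      linear_combination p s * w1 + e * ea ha.symm
    · rw [if_pos ⟨ha, hb.le⟩]
      linear_combination p s * w1
  rcases lt_or_ge s c with hc | hc
  · rw [if_pos ha, if_pos hb, if_neg (by linarith)]
    rcases hb.eq_or_lt with hb | hb
    · rw [if_pos ⟨by linarith, by linarith⟩, (eb hb.symm).1, (eb hb.symm).2]
      linear_combination pb * w1
    · rw [if_neg (by rintro ⟨_, _⟩; linarith), if_pos ⟨hb, hc⟩]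
      linear_combination q s * w2
  · rw [if_pos ha, if_pos hb, if_pos hc, if_neg (by rintro ⟨_, _⟩; linarith),
      if_neg (by rintro ⟨_, _⟩; linarith)]
    linear_combination q s * w2

include hp hq hr in
theorem basisFun1_node {l i m : ℕ} (h0 : 0 < i) (h1 : i < 2 ^ l) :
    basisFun1 p q l i (node l m) = if m = i then 1 else 0 := by
  unfold basisFun1
  simp only [Set.mem_Ioc, Set.mem_Ioo, node_lt_node, node_le_node]
  split_ifs with h2 h3 h4 h5 h6
  · have d1 := nodeDet_pos hp hq hr (show i - 1 < i by omega) (show i ≤ 2 ^ l by omega)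
    subst h3
    rw [← pNode_of_mem (p := p) h0 h1, ← qNode_of_mem (q := q) h0 h1]
    exact div_self d1.ne'
  all_goals first | rfl | omega

include hp hq hr in
-- A node of level l has, at a strictly finer level l', an even index, hence differs from the odd
-- centre i'; at equal levels the neighbours of i are even. So at most the centre term survives.
theorem sum_coef1_mul_basisFun1 {l i l' i' : ℕ} (hi : Odd i) (h1 : i < 2 ^ l) (hi' : Odd i')
    (h1' : i' < 2 ^ l') (hl : l ≤ l') :
    ∑ t ∈ nbr l i, coef1 p q l i t * basisFun1 p q l' i' t =
      if l = l' ∧ i = i' then nodeRatio p q l i else 0 := by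
  obtain ⟨k, rfl⟩ := Nat.exists_eq_add_of_le hl
  have key : ∀ m, basisFun1 p q (l + k) i' (node l m) = if m * 2 ^ k = i' then 1 else 0 := by
    intro m
    rw [← node_add_mul_two_pow l k, basisFun1_node hp hq hr hi'.pos h1']
  split_ifs with h
  · obtain ⟨hk, rfl⟩ := h
    obtain rfl : k = 0 := by omega
    rw [Finset.sum_eq_single (node l i)]
    · rw [key, if_pos (by simp), coef1_self, mul_one]
    · intro t ht hne
      obtain ⟨m, -, -, -, rfl⟩ := mem_nbr.1 ht
      rw [key, if_neg, mul_zero]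
      rintro rfl
      simp at hne
    · exact fun h => absurd (self_mem_nbr hi.pos h1) h
  · refine Finset.sum_eq_zero fun t ht => ?_
    obtain ⟨m, hm, -, -, rfl⟩ := mem_nbr.1 ht
    rw [key, if_neg, mul_zero]
    rintro rfl
    rw [Nat.odd_mul] at hi'
    have hk : k = 0 := by
      by_contra hk
      exact (Nat.not_even_iff_odd.2 hi'.2) (Nat.even_pow.2 ⟨even_two, hk⟩)
    subst hk
    obtain ⟨r, rfl⟩ := hi
    obtain ⟨r', rfl⟩ := hi'.1
    simp at h
    omega

/-- The inner product of two basis functions in terms of their coefficients. -/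
noncomputable def gram1 (p q : ℝ → ℝ) (l i l' i' : ℕ) : ℝ :=
  ∑ s ∈ nbr l i, ∑ t ∈ nbr l' i', coef1 p q l i s * kernel1 p q s t * coef1 p q l' i' t

theorem gram1_comm (l i l' i' : ℕ) : gram1 p q l i l' i' = gram1 p q l' i' l i := by
  unfold gram1
  rw [Finset.sum_comm]
  refine Finset.sum_congr rfl fun s _ => Finset.sum_congr rfl fun t _ => ?_
  rw [kernel1_comm]
  ring

include hp hq hr in
/-- The hierarchical basis functions are orthogonal. -/
theorem gram1_eq {l i l' i' : ℕ} (hi : Odd i) (h1 : i < 2 ^ l) (hi' : Odd i') (h1' : i' < 2 ^ l') :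
    gram1 p q l i l' i' = if l = l' ∧ i = i' then nodeRatio p q l i else 0 := by
  wlog hl : l ≤ l' generalizing l i l' i'
  · rw [gram1_comm, this hi' h1' hi h1 (by omega)]
    by_cases h : l = l' ∧ i = i'
    · rw [if_pos h, if_pos ⟨h.1.symm, h.2.symm⟩, h.1, h.2]
    · rw [if_neg h, if_neg fun h' => h ⟨h'.1.symm, h'.2.symm⟩]
  rw [← sum_coef1_mul_basisFun1 hp hq hr hi h1 hi' h1' hl]
  refine Finset.sum_congr rfl fun s hs => ?_
  -- Reproducing property: the inner sum is the value of the finer basis function at `s`.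
  rw [← sum_coef1_mul_kernel1 hp hq hr hi'.pos h1'
    (mem_Ioo_of_mem_dyadicGrid (nbr_subset_dyadicGrid _ _ hs)), Finset.mul_sum]
  refine Finset.sum_congr rfl fun t _ => ?_
  rw [kernel1_comm]
  ring

end OneDim

/-! ### Tensor products -/

section Tensor

variable {d : ℕ} {p q : Fin d → ℝ → ℝ}

/-- The grid point together with its neighbours in all coordinate directions. -/
noncomputable def nbrs (l i : Fin d → ℕ) : Finset (Fin d → ℝ) :=
  Fintype.piFinset fun j => nbr (l j) (i j)

/-- The coefficients of a tensor product basis function in the kernel functions. -/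
noncomputable def coef (p q : Fin d → ℝ → ℝ) (l i : Fin d → ℕ) (y : Fin d → ℝ) : ℝ :=
  ∏ j, coef1 (p j) (q j) (l j) (i j) (y j)

theorem tmKernel_eq_prod (x y : Fin d → ℝ) :
    tmKernel p q x y = ∏ j, kernel1 (p j) (q j) (x j) (y j) := rfl

theorem mem_nbrs {l i : Fin d → ℕ} {y : Fin d → ℝ} :
    y ∈ nbrs l i ↔ ∀ j, y j ∈ nbr (l j) (i j) := Fintype.mem_piFinset

theorem card_nbrs_le (l i : Fin d → ℕ) : (nbrs l i).card ≤ 3 ^ d := by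
  unfold nbrs
  rw [Fintype.card_piFinset]
  refine (Finset.prod_le_pow_card _ _ 3 fun j _ => card_nbr_le _ _).trans ?_
  simp

theorem mem_Ioo_of_mem_nbrs {l i : Fin d → ℕ} {y : Fin d → ℝ} (h : y ∈ nbrs l i) (j : Fin d) :
    y j ∈ Set.Ioo (0 : ℝ) 1 :=
  mem_Ioo_of_mem_dyadicGrid (nbr_subset_dyadicGrid _ _ (mem_nbrs.1 h j))

theorem coef_gridPoint (l i : Fin d → ℕ) :
    coef p q l i (gridPoint l i) = ∏ j, nodeRatio (p j) (q j) (l j) (i j) :=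
  Finset.prod_congr rfl fun _ _ => coef1_self _ _

theorem coef_eq_zero {l i : Fin d → ℕ} {y : Fin d → ℝ} (hy : ∀ j, y j ∈ Set.Ioo (0 : ℝ) 1)
    (h : y ∉ nbrs l i) : coef p q l i y = 0 := by
  simp only [mem_nbrs, not_forall] at h
  obtain ⟨j, hj⟩ := h
  exact Finset.prod_eq_zero (Finset.mem_univ j) (coef1_eq_zero (hy j) hj)

theorem IsTMPair.prod_nodeRatio_pos (hTM : IsTMPair p q) {l i : Fin d → ℕ} (h : IsIndex l i) :
    0 < ∏ j, nodeRatio (p j) (q j) (l j) (i j) :=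
  Finset.prod_pos fun j _ => nodeRatio_pos (hTM.p_pos j) (hTM.q_pos j) (hTM.ratio_strictMono j)
    (h j).1.pos (h j).2

theorem IsTMPair.sum_coef_mul_tmKernel (hTM : IsTMPair p q) {l i : Fin d → ℕ} (h : IsIndex l i)
    {s : Fin d → ℝ} (hs : ∀ j, s j ∈ Set.Ioo (0 : ℝ) 1) :
    ∑ t ∈ nbrs l i, coef p q l i t * tmKernel p q t s = basisFun p q l i s := by
  simp only [coef, tmKernel_eq_prod, ← Finset.prod_mul_distrib]
  unfold nbrs basisFun
  rw [← Finset.prod_univ_sum (fun j => nbr (l j) (i j)) fun j t =>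
    coef1 (p j) (q j) (l j) (i j) t * kernel1 (p j) (q j) t (s j)]
  exact Finset.prod_congr rfl fun j _ => sum_coef1_mul_kernel1 (hTM.p_pos j) (hTM.q_pos j)
    (hTM.ratio_strictMono j) (h j).1.pos (h j).2 (hs j)

/-- Coefficients, kernel and stencils are all products, so the double sum is a product of
one-dimensional Gram entries; one differing coordinate makes it zero. -/
theorem IsTMPair.sum_sum_coef_mul_tmKernel_mul_coef (hTM : IsTMPair p q) {l i l' i' : Fin d → ℕ}
    (h : IsIndex l i) (h' : IsIndex l' i') :
    ∑ s ∈ nbrs l i, ∑ t ∈ nbrs l' i', coef p q l i s * tmKernel p q s t * coef p q l' i' t =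
      if l = l' ∧ i = i' then ∏ j, nodeRatio (p j) (q j) (l j) (i j) else 0 := by
  have : ∑ s ∈ nbrs l i, ∑ t ∈ nbrs l' i',
      coef p q l i s * tmKernel p q s t * coef p q l' i' t =
      ∏ j, gram1 (p j) (q j) (l j) (i j) (l' j) (i' j) := by
    unfold gram1
    rw [Finset.prod_univ_sum]
    refine Finset.sum_congr rfl fun s _ => ?_
    rw [Finset.prod_univ_sum]
    refine Finset.sum_congr rfl fun t _ => ?_
    simp only [coef, tmKernel_eq_prod, ← Finset.prod_mul_distrib]
  rw [this, Finset.prod_congr rfl fun j _ => gram1_eq (hTM.p_pos j) (hTM.q_pos j)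
    (hTM.ratio_strictMono j) (h j).1 (h j).2 (h' j).1 (h' j).2]
  split_ifs with hc
  · obtain ⟨rfl, rfl⟩ := hc
    simp
  · have : ∃ j, ¬(l j = l' j ∧ i j = i' j) := by
      by_contra! hall
      exact hc ⟨funext fun j => (hall j).1, funext fun j => (hall j).2⟩
    obtain ⟨j, hj⟩ := this
    exact Finset.prod_eq_zero (Finset.mem_univ j) (if_neg hj)

/-- The basis functions belong to the reproducing kernel Hilbert space. -/
theorem IsTMPair.exists_basisFun_mem (hTM : IsTMPair p q) {l i : Fin d → ℕ} (h : IsIndex l i)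
    (H : Type*) [NormedAddCommGroup H] [InnerProductSpace ℝ H] [CompleteSpace H]
    [RKHS ℝ H (UnitCube d) ℝ] (hH : HasTMKernel p q H) :
    ∃ φ : H, (∀ x : UnitCube d, φ x = basisFun p q l i x.1) ∧
      ∏ j, nodeRatio (p j) (q j) (l j) (i j) = ‖φ‖ ^ 2 := by
  let f : nbrs l i → H := fun y =>
    coef p q l i y • RKHS.kerFun H (⟨y, mem_Ioo_of_mem_nbrs y.2⟩ : UnitCube d) 1
  have hf : ∀ (y : nbrs l i) (x : UnitCube d), (f y) x = coef p q l i y * tmKernel p q y x := by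
    intro y x
    have := hH x ⟨y, mem_Ioo_of_mem_nbrs y.2⟩
    rw [← RKHS.kerFun_apply] at this
    simp only [f, RKHS.coe_smul, Pi.smul_apply, smul_eq_mul, this]
    congr 1
    simp only [tmKernel_eq_prod]
    exact Finset.prod_congr rfl fun j _ => kernel1_comm _ _ _ _
  have hsum : ∀ x : UnitCube d, (∑ y, f y) x = ∑ y, (f y) x := by
    intro x
    -- Evaluation at `x` is the adjoint of a kernel map, hence linear.
    rw [← RKHS.adjoint_kerFun, map_sum]
    simp only [RKHS.adjoint_kerFun]
  refine ⟨∑ y, f y, fun x => ?_, ?_⟩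
  · rw [hsum, ← hTM.sum_coef_mul_tmKernel h x.2, ← Finset.sum_coe_sort (nbrs l i)]
    exact Finset.sum_congr rfl fun y _ => hf y x
  · have := hTM.sum_sum_coef_mul_tmKernel_mul_coef h h
    rw [if_pos ⟨rfl, rfl⟩] at this
    rw [← this, ← real_inner_self_eq_norm_sq, sum_inner, ← Finset.sum_coe_sort (nbrs l i)]
    refine Finset.sum_congr rfl fun y _ => ?_
    rw [inner_sum, ← Finset.sum_coe_sort (nbrs l i)]
    refine Finset.sum_congr rfl fun z _ => ?_
    conv_rhs => rw [show f z = coef p q l i z •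
      RKHS.kerFun H (⟨z, mem_Ioo_of_mem_nbrs z.2⟩ : UnitCube d) 1 from rfl]
    rw [inner_smul_right, RKHS.inner_kerFun, hf]
    simp
    ring

end Tensor

/-! ### Sparse grids -/

section SparseGrid

variable {d : ℕ}

theorem gridPoint_inj {l i l' i' : Fin d → ℕ} (h : IsIndex l i) (h' : IsIndex l' i') :
    gridPoint l i = gridPoint l' i' ↔ l = l' ∧ i = i' := by
  constructor
  · intro he
    have := fun j => odd_node_inj (h j).1 (h' j).1 (congrFun he j)
    exact ⟨funext fun j => (this j).1, funext fun j => (this j).2⟩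
  · rintro ⟨rfl, rfl⟩
    rfl

theorem mem_sparseGrid {τ : ℕ} {x : Fin d → ℝ} :
    x ∈ sparseGrid d τ ↔ ∃ l : Fin d → ℕ, ∑ j, l j ≤ τ + d - 1 ∧ ∀ j, x j ∈ dyadicGrid (l j) := by
  unfold sparseGrid
  simp only [Finset.mem_biUnion, Finset.mem_filter, Fintype.mem_piFinset, Finset.mem_Icc]
  constructor
  · rintro ⟨l, ⟨-, h⟩, h'⟩
    exact ⟨l, h, h'⟩
  · rintro ⟨l, h, h'⟩
    refine ⟨l, ⟨fun j => ⟨?_, ?_⟩, h⟩, h'⟩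
    · obtain ⟨i, h1, h2, -⟩ := mem_dyadicGrid.1 (h' j)
      by_contra hl
      obtain h0 : l j = 0 := by omega
      rw [h0] at h2
      omega
    · exact (Finset.single_le_sum (f := l) (fun _ _ => Nat.zero_le _) (Finset.mem_univ j)).trans h

theorem sparseGrid_mono {τ τ' : ℕ} (h : τ ≤ τ') : sparseGrid d τ ⊆ sparseGrid d τ' := by
  intro x hx
  obtain ⟨l, hl, hx⟩ := mem_sparseGrid.1 hx
  exact mem_sparseGrid.2 ⟨l, by omega, hx⟩

theorem sum_level_le_of_gridPoint_mem {τ : ℕ} {l i : Fin d → ℕ} (h : IsIndex l i)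
    (hx : gridPoint l i ∈ sparseGrid d τ) : ∑ j, l j ≤ τ + d - 1 := by
  obtain ⟨m, hm, hx⟩ := mem_sparseGrid.1 hx
  exact (Finset.sum_le_sum fun j _ => le_of_odd_node_mem_dyadicGrid (h j).1 (hx j)).trans hm

theorem exists_isIndex_of_mem_sparseGrid {τ : ℕ} {x : Fin d → ℝ} (hx : x ∈ sparseGrid d τ) :
    ∃ l i : Fin d → ℕ, IsIndex l i ∧ gridPoint l i = x := by
  obtain ⟨m, -, hx⟩ := mem_sparseGrid.1 hx
  choose l i _ h1 h2 h3 using fun j => exists_odd_of_mem_dyadicGrid (hx j)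
  exact ⟨l, i, fun j => ⟨h1 j, h2 j⟩, funext h3⟩

theorem nbrs_subset_sparseGrid {τ : ℕ} {l i : Fin d → ℕ} (h : IsIndex l i)
    (hx : gridPoint l i ∈ sparseGrid d τ) : nbrs l i ⊆ sparseGrid d τ := fun _ hy =>
  mem_sparseGrid.2 ⟨l, sum_level_le_of_gridPoint_mem h hx, fun j =>
    nbr_subset_dyadicGrid _ _ (mem_nbrs.1 hy j)⟩

/-- The neighbours of a point of a sparse grid, except the point itself, belong to the sparse grid
of the preceding level. -/
theorem mem_sparseGrid_of_mem_nbrs {τ : ℕ} {l i : Fin d → ℕ} (h : IsIndex l i)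
    (hx : gridPoint l i ∈ sparseGrid d (τ + 1)) {y : Fin d → ℝ} (hy : y ∈ nbrs l i)
    (hne : y ≠ gridPoint l i) : y ∈ sparseGrid d τ := by
  have hl := sum_level_le_of_gridPoint_mem h hx
  have key : ∀ j, ∃ m, m ≤ l j ∧ y j ∈ dyadicGrid m ∧ (y j ≠ node (l j) (i j) → m < l j) := by
    intro j
    have hj := mem_nbrs.1 hy j
    rcases eq_or_mem_dyadicGrid_of_mem_nbr (h j).1 hj with he | ⟨m, hm, hmem⟩
    · exact ⟨l j, le_rfl, nbr_subset_dyadicGrid _ _ hj, fun hne => absurd he hne⟩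
    · exact ⟨m, by omega, hmem, fun _ => by omega⟩
  choose m hm hmem hlt using key
  obtain ⟨j, hj⟩ := Function.ne_iff.1 hne
  -- A coordinate that moves drops at least one level, which pays for passing from τ+1 to τ.
  have : ∑ j, m j < ∑ j, l j :=
    Finset.sum_lt_sum (fun j _ => hm j) ⟨j, Finset.mem_univ j, hlt j hj⟩
  exact mem_sparseGrid.2 ⟨m, by omega, hmem⟩

/-- One coordinate runs through the three nodes of level 2 while the others stay at 1/2. The bound 3
> e makes the logarithm of the cardinality at least 1. -/
theorem three_le_card_sparseGrid (hd : 1 ≤ d) {τ : ℕ} (hτ : 2 ≤ τ) :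
    3 ≤ (sparseGrid d τ).card := by
  have hc : (dyadicGrid 2).card = 3 := by
    unfold dyadicGrid
    rw [Finset.card_image_of_injective _ fun a b h => node_inj.1 h]
    simp
  rw [← hc]
  let j₀ : Fin d := ⟨0, hd⟩
  refine Finset.card_le_card_of_injOn (fun x => Function.update (fun _ => node 1 1) j₀ x) ?_ ?_
  · intro x hx
    refine mem_sparseGrid.2 ⟨Function.update (fun _ => 1) j₀ 2, ?_, fun j => ?_⟩
    · rw [Finset.sum_update_of_mem (Finset.mem_univ _)]
      simp [Finset.card_sdiff]
      omega
    · by_cases hj : j = j₀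
      · subst hj
        simpa using hx
      · simp only [Function.update_of_ne hj]
        exact mem_dyadicGrid.2 ⟨1, by norm_num, by norm_num, rfl⟩
  · exact fun x _ y _ h => Function.update_injective _ _ h

end SparseGrid

/-! ### Inverses of kernel matrices on hierarchical designs -/

/-- Both nodes lie within 2^{-u} of the centre of the stencil. If the finer one is the centre, then
l' = u; otherwise it belongs to the next coarser grid, l' < u, and the distance is at most 2 ·
2^{-u} ≤ 2^{-l'}. -/
theorem abs_sub_lt_two_of_mem_nbr {l i l' i' u v : ℕ} (hv : Odd v) (hi' : Odd i') (hl : l ≤ l')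
    (h : node l i ∈ nbr u v) (h' : node l' i' ∈ nbr u v) :
    |(i : ℤ) * 2 ^ (l' - l) - i'| < 2 := by
  obtain ⟨k, rfl⟩ := Nat.exists_eq_add_of_le hl
  rw [Nat.add_sub_cancel_left]
  have e : node l i - node (l + k) i' = ((i : ℝ) * 2 ^ k - i') / 2 ^ (l + k) := by
    rw [← node_add_mul_two_pow l k]
    unfold node
    push_cast
    ring
  have b := abs_sub_le_of_mem_nbr h
  have key : |node l i - node (l + k) i'| < 2 / 2 ^ (l + k) := by
    rcases eq_or_mem_dyadicGrid_of_mem_nbr hv h' with he | ⟨m, hm, hmem⟩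
    · obtain ⟨rfl, rfl⟩ := odd_node_inj hi' hv he
      refine b.trans_lt ?_
      gcongr
      norm_num
    · have hlm := le_of_odd_node_mem_dyadicGrid hi' hmem
      have b' := abs_sub_le_of_mem_nbr h'
      rw [abs_sub_comm] at b'
      subst hm
      calc |node l i - node (l + k) i'| ≤ 1 / 2 ^ (m + 1) + 1 / 2 ^ (m + 1) :=
            (abs_sub_le _ (node (m + 1) v) _).trans (add_le_add b b')
        _ = 1 / 2 ^ m := by rw [pow_succ]; field_simp; norm_num
        _ ≤ 1 / 2 ^ (l + k) := by gcongr; norm_num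
        _ < 2 / 2 ^ (l + k) := by gcongr; norm_num
  rw [e, abs_div, abs_of_pos (by positivity : (0 : ℝ) < 2 ^ (l + k)),
    div_lt_div_iff_of_pos_right (by positivity)] at key
  exact_mod_cast key

/-- An odd node whose neighbours include a given odd node lies in the support of the basis function
around the latter. -/
theorem node_mem_Ioo_of_mem_nbr {l i u v : ℕ} (hi : Odd i) (hv : Odd v)
    (h : node l i ∈ nbr u v) : node u v ∈ Set.Ioo (node l (i - 1)) (node l (i + 1)) := by
  have e1 : node l (i - 1) = node l i - 1 / 2 ^ l := by
    unfold node
    rw [Nat.cast_sub hi.pos]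
    push_cast
    ring
  have e2 : node l (i + 1) = node l i + 1 / 2 ^ l := by
    unfold node
    push_cast
    ring
  have hpos : (0 : ℝ) < 1 / 2 ^ l := by positivity
  -- Strict because an odd node other than the centre has level l < u.
  have key : |node l i - node u v| < 1 / 2 ^ l := by
    rcases eq_or_mem_dyadicGrid_of_mem_nbr hv h with he | ⟨m, hm, hmem⟩
    · rwa [he, sub_self, abs_zero]
    · have hlm := le_of_odd_node_mem_dyadicGrid hi hmem
      refine (abs_sub_le_of_mem_nbr h).trans_lt ?_
      apply one_div_lt_one_div_of_lt (by positivity)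
      exact pow_lt_pow_right₀ (by norm_num) (by omega)
  rw [abs_lt] at key
  rw [e1, e2]
  constructor <;> linarith [key.1, key.2]

section Hierarchical

variable {d : ℕ} {p q : Fin d → ℝ → ℝ}

open Classical in
/-- The level of a grid point. -/
noncomputable def level (x : Fin d → ℝ) : Fin d → ℕ :=
  if h : ∃ l i : Fin d → ℕ, IsIndex l i ∧ gridPoint l i = x then h.choose else 0

open Classical in
/-- The index of a grid point in its level. -/
noncomputable def index (x : Fin d → ℝ) : Fin d → ℕ :=
  if h : ∃ l i : Fin d → ℕ, IsIndex l i ∧ gridPoint l i = x then h.choose_spec.choose else 0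

theorem level_index_spec {x : Fin d → ℝ} (h : ∃ l i : Fin d → ℕ, IsIndex l i ∧ gridPoint l i = x) :
    IsIndex (level x) (index x) ∧ gridPoint (level x) (index x) = x := by
  unfold level index
  rw [dif_pos h, dif_pos h]
  exact h.choose_spec.choose_spec

theorem level_gridPoint {l i : Fin d → ℕ} (h : IsIndex l i) : level (gridPoint l i) = l :=
  have hs := level_index_spec ⟨l, i, h, rfl⟩
  ((gridPoint_inj hs.1 h).1 hs.2).1

theorem index_gridPoint {l i : Fin d → ℕ} (h : IsIndex l i) : index (gridPoint l i) = i :=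
  have hs := level_index_spec ⟨l, i, h, rfl⟩
  ((gridPoint_inj hs.1 h).1 hs.2).2

/-- The neighbours of a grid point. -/
noncomputable def stencil (x : Fin d → ℝ) : Finset (Fin d → ℝ) := nbrs (level x) (index x)

/-- A finite set of grid points that contains the neighbours of each of its points. -/
def IsHierarchical (X : Finset (Fin d → ℝ)) : Prop :=
  ∀ x ∈ X, (∃ l i : Fin d → ℕ, IsIndex l i ∧ gridPoint l i = x) ∧ stencil x ⊆ X

/-- The squared norm of the basis function at a grid point. -/
noncomputable def weight (p q : Fin d → ℝ → ℝ) (x : Fin d → ℝ) : ℝ :=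
  ∏ j, nodeRatio (p j) (q j) (level x j) (index x j)

/-- The coefficients of the basis functions of a design in the kernel functions. -/
noncomputable def hierMatrix (p q : Fin d → ℝ → ℝ) (X : Finset (Fin d → ℝ)) : Matrix X X ℝ :=
  Matrix.of fun x y => coef p q (level x.1) (index x.1) y

variable {X : Finset (Fin d → ℝ)}

theorem IsHierarchical.isIndex (hX : IsHierarchical X) {x : Fin d → ℝ} (hx : x ∈ X) :
    IsIndex (level x) (index x) := (level_index_spec (hX x hx).1).1

theorem IsHierarchical.gridPoint_eq (hX : IsHierarchical X) {x : Fin d → ℝ} (hx : x ∈ X) :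
    gridPoint (level x) (index x) = x := (level_index_spec (hX x hx).1).2

theorem IsHierarchical.mem_Ioo (hX : IsHierarchical X) {x : Fin d → ℝ} (hx : x ∈ X) (j : Fin d) :
    x j ∈ Set.Ioo (0 : ℝ) 1 := by
  rw [← hX.gridPoint_eq hx]
  exact node_mem_Ioo.2 ⟨(hX.isIndex hx j).1.pos, (hX.isIndex hx j).2⟩

theorem IsHierarchical.weight_pos (hTM : IsTMPair p q) (hX : IsHierarchical X) {x : Fin d → ℝ}
    (hx : x ∈ X) : 0 < weight p q x := hTM.prod_nodeRatio_pos (hX.isIndex hx)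

theorem IsHierarchical.coef_self (hX : IsHierarchical X) {x : Fin d → ℝ} (hx : x ∈ X) :
    coef p q (level x) (index x) x = weight p q x := by
  conv_lhs => rw [← hX.gridPoint_eq hx]
  rw [level_gridPoint (hX.isIndex hx), index_gridPoint (hX.isIndex hx)]
  exact coef_gridPoint _ _

theorem IsHierarchical.mem_stencil_of_coef_ne_zero (hX : IsHierarchical X) {x y : Fin d → ℝ}
    (hy : y ∈ X) (h : coef p q (level x) (index x) y ≠ 0) : y ∈ stencil x := by
  by_contra hn
  exact h (coef_eq_zero (hX.mem_Ioo hy) hn)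

/-- This is where closure under neighbours enters: no term of the expansion of a basis function is
lost by restricting to X. -/
theorem IsHierarchical.sum_eq_sum_stencil (hX : IsHierarchical X) {x : Fin d → ℝ} (hx : x ∈ X)
    (f : (Fin d → ℝ) → ℝ) (hf : ∀ y, coef p q (level x) (index x) y = 0 → f y = 0) :
    ∑ y : X, f y = ∑ y ∈ stencil x, f y := by
  rw [Finset.sum_coe_sort X f]
  refine (Finset.sum_subset (hX x hx).2 fun y hy hn => hf y ?_).symm
  exact coef_eq_zero (hX.mem_Ioo hy) hn

theorem IsHierarchical.hierMatrix_mul_kernelMatrix_mul (hTM : IsTMPair p q)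
    (hX : IsHierarchical X) :
    hierMatrix p q X * (kernelMatrix p q X X * (hierMatrix p q X).transpose) =
      Matrix.diagonal fun x : X => weight p q x := by
  ext x x'
  rw [Matrix.mul_apply, Matrix.diagonal_apply]
  have h1 : ∀ y : X, hierMatrix p q X x y *
      (kernelMatrix p q X X * (hierMatrix p q X).transpose) y x' =
      ∑ z ∈ stencil x'.1, coef p q (level x.1) (index x.1) y * tmKernel p q y z *
        coef p q (level x'.1) (index x'.1) z := by
    intro y
    rw [Matrix.mul_apply, Finset.mul_sum, ← hX.sum_eq_sum_stencil (p := p) (q := q) x'.2 _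
      (fun z hz => by rw [hz, mul_zero])]
    exact Finset.sum_congr rfl fun z _ => (mul_assoc _ _ _).symm
  rw [Finset.sum_congr rfl fun y _ => h1 y, hX.sum_eq_sum_stencil (p := p) (q := q) x.2
    (fun y => ∑ z ∈ stencil x'.1, coef p q (level x.1) (index x.1) y * tmKernel p q y z *
        coef p q (level x'.1) (index x'.1) z) (fun y hy => by simp [hy])]
  refine (hTM.sum_sum_coef_mul_tmKernel_mul_coef (hX.isIndex x.2) (hX.isIndex x'.2)).trans ?_
  simp only [← gridPoint_inj (hX.isIndex x.2) (hX.isIndex x'.2), hX.gridPoint_eq x.2,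
    hX.gridPoint_eq x'.2, Subtype.ext_iff]
  rfl

theorem IsHierarchical.kernelMatrix_mul (hTM : IsTMPair p q) (hX : IsHierarchical X) :
    kernelMatrix p q X X * ((hierMatrix p q X).transpose *
      (Matrix.diagonal (fun x : X => (weight p q x)⁻¹) * hierMatrix p q X)) = 1 := by
  have h := congrArg (· * Matrix.diagonal fun x : X => (weight p q x)⁻¹)
    (hX.hierMatrix_mul_kernelMatrix_mul hTM)
  simp only [Matrix.diagonal_mul_diagonal, Matrix.mul_assoc] at h
  have h1 : (Matrix.diagonal fun x : X => weight p q x * (weight p q x)⁻¹) =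
      (1 : Matrix X X ℝ) := by
    rw [← Matrix.diagonal_one]
    exact congrArg _ (funext fun x => mul_inv_cancel₀ (hX.weight_pos hTM x.2).ne')
  -- One-sided inverses of square matrices are two-sided, so Φ can be moved cyclically from the left
  -- end to the right.
  rw [h1, mul_eq_one_comm] at h
  simpa only [Matrix.mul_assoc] using h

theorem IsHierarchical.isUnit_det (hTM : IsTMPair p q) (hX : IsHierarchical X) :
    IsUnit (kernelMatrix p q X X).det :=
  Matrix.isUnit_det_of_right_inverse (hX.kernelMatrix_mul hTM)

theorem IsHierarchical.inv_apply (hTM : IsTMPair p q) (hX : IsHierarchical X) (y z : X) :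
    (kernelMatrix p q X X)⁻¹ y z = ∑ x : X, coef p q (level x.1) (index x.1) y *
      ((weight p q x)⁻¹ * coef p q (level x.1) (index x.1) z) := by
  rw [Matrix.inv_eq_right_inv (hX.kernelMatrix_mul hTM), Matrix.mul_apply]
  refine Finset.sum_congr rfl fun x _ => ?_
  rw [Matrix.diagonal_mul]
  rfl

theorem IsHierarchical.exists_mem_stencil (hTM : IsTMPair p q) (hX : IsHierarchical X) {y z : X}
    (h : (kernelMatrix p q X X)⁻¹ y z ≠ 0) :
    ∃ x ∈ X, y.1 ∈ stencil x ∧ z.1 ∈ stencil x := by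
  rw [hX.inv_apply hTM] at h
  obtain ⟨x, -, hx⟩ := Finset.exists_ne_zero_of_sum_ne_zero h
  exact ⟨x, x.2, hX.mem_stencil_of_coef_ne_zero y.2 (left_ne_zero_of_mul hx),
    hX.mem_stencil_of_coef_ne_zero z.2 (right_ne_zero_of_mul (right_ne_zero_of_mul hx))⟩

/-- The column of the inverse kernel matrix at a point that is no neighbour of another point. -/
theorem IsHierarchical.inv_apply_of_finest (hTM : IsTMPair p q) (hX : IsHierarchical X) (y z : X)
    (hz : ∀ x ∈ X, z.1 ∈ stencil x → x = z) :
    (kernelMatrix p q X X)⁻¹ y z = coef p q (level z.1) (index z.1) y := by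
  rw [hX.inv_apply hTM, Finset.sum_eq_single z]
  · rw [hX.coef_self z.2, inv_mul_cancel₀ (hX.weight_pos hTM z.2).ne', mul_one]
  · intro x _ hne
    by_contra h
    exact hne (Subtype.ext (hz x x.2 (hX.mem_stencil_of_coef_ne_zero z.2
      (right_ne_zero_of_mul (right_ne_zero_of_mul h)))))
  · simp

theorem tmKernel_comm (x y : Fin d → ℝ) : tmKernel p q x y = tmKernel p q y x := by
  simp only [tmKernel_eq_prod]
  exact Finset.prod_congr rfl fun j _ => kernel1_comm _ _ _ _

theorem kernelMatrix_transpose (S T : Finset (Fin d → ℝ)) :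
    (kernelMatrix p q S T).transpose = kernelMatrix p q T S := by
  ext x y
  exact tmKernel_comm _ _

theorem inv_kernelMatrix_comm (x y : X) :
    (kernelMatrix p q X X)⁻¹ x y = (kernelMatrix p q X X)⁻¹ y x := by
  have := Matrix.transpose_nonsing_inv (kernelMatrix p q X X)
  rw [kernelMatrix_transpose] at this
  exact congrFun (congrFun this y) x

theorem card_stencil_le (x : Fin d → ℝ) : (stencil x).card ≤ 3 ^ d := card_nbrs_le _ _

/-- Two points are separated by two mesh widths of the finer of their levels in some coordinate
direction only if they have no common neighbour. -/
theorem not_mem_stencil_of_separated {x : Fin d → ℝ} (hx : IsIndex (level x) (index x))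
    {l' i' l'' i'' : Fin d → ℕ} (h' : IsIndex l' i') (h'' : IsIndex l'' i'') {j : Fin d}
    (hj : 2 ≤ |(i' j : ℤ) * 2 ^ (max (l' j) (l'' j) - l' j) -
      (i'' j : ℤ) * 2 ^ (max (l' j) (l'' j) - l'' j)|)
    (hx' : gridPoint l' i' ∈ stencil x) : gridPoint l'' i'' ∉ stencil x := by
  intro hx''
  wlog hl : l' j ≤ l'' j generalizing l' i' l'' i''
  · refine this h'' h' ?_ hx'' hx' (by omega)
    rw [abs_sub_comm, max_comm]
    exact hj
  rw [max_eq_right hl, Nat.sub_self, pow_zero, mul_one] at hj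
  have m' : node (l' j) (i' j) ∈ nbr (level x j) (index x j) := mem_nbrs.1 hx' j
  have m'' : node (l'' j) (i'' j) ∈ nbr (level x j) (index x j) := mem_nbrs.1 hx'' j
  exact absurd hj (not_le.2 (abs_sub_lt_two_of_mem_nbr (hx j).1 (h'' j).1 hl m' m''))

end Hierarchical

/-! ### Truncated sparse grids as hierarchical designs -/

section TruncatedSparseGrid

variable {d : ℕ} {p q : Fin d → ℝ → ℝ}

theorem isHierarchical_sparseGrid (d τ : ℕ) : IsHierarchical (sparseGrid d τ) := by
  intro x hx
  have h := exists_isIndex_of_mem_sparseGrid hx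
  obtain ⟨h1, h2⟩ := level_index_spec h
  refine ⟨h, nbrs_subset_sparseGrid h1 ?_⟩
  rwa [h2]

theorem mem_sparseGrid_of_mem_stencil {τ : ℕ} {x y : Fin d → ℝ} (hx : x ∈ sparseGrid d (τ + 1))
    (hy : y ∈ stencil x) (hne : y ≠ x) : y ∈ sparseGrid d τ := by
  obtain ⟨h1, h2⟩ := level_index_spec (exists_isIndex_of_mem_sparseGrid hx)
  exact mem_sparseGrid_of_mem_nbrs h1 (by rwa [h2]) hy (by rwa [h2])

namespace IsTSG

variable {n τ : ℕ} {A : Finset (Fin d → ℝ)} (hA : IsTSG n τ A)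

include hA

theorem subset_sparseGrid_succ : sparseGrid d τ ∪ A ⊆ sparseGrid d (τ + 1) :=
  Finset.union_subset (sparseGrid_mono (Nat.le_succ τ)) (hA.subset.trans Finset.sdiff_subset)

theorem isHierarchical : IsHierarchical (sparseGrid d τ ∪ A) := by
  intro x hx
  refine ⟨exists_isIndex_of_mem_sparseGrid (hA.subset_sparseGrid_succ hx), fun y hy => ?_⟩
  by_cases hne : y = x
  · rwa [hne]
  · exact Finset.mem_union_left _
      (mem_sparseGrid_of_mem_stencil (hA.subset_sparseGrid_succ hx) hy hne)

/-- A point of a stencil other than its centre would lie in the grid of level τ, from which A is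
disjoint. -/
theorem eq_of_mem_stencil {x z : Fin d → ℝ} (hx : x ∈ sparseGrid d τ ∪ A) (hz : z ∈ A)
    (h : z ∈ stencil x) : x = z := by
  by_contra hne
  exact Finset.disjoint_left.1 hA.disjoint
    (mem_sparseGrid_of_mem_stencil (hA.subset_sparseGrid_succ hx) h (Ne.symm hne)) hz

theorem inv_apply (hTM : IsTMPair p q) (y z : ↥(sparseGrid d τ ∪ A)) (hz : z.1 ∈ A) :
    (kernelMatrix p q (sparseGrid d τ ∪ A) (sparseGrid d τ ∪ A))⁻¹ y z =
      coef p q (level z.1) (index z.1) y :=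
  hA.isHierarchical.inv_apply_of_finest hTM y z fun _ hx h => hA.eq_of_mem_stencil hx hz h

theorem mem_stencil_of_inv_ne_zero (hTM : IsTMPair p q) {y z : ↥(sparseGrid d τ ∪ A)}
    (hz : z.1 ∈ A)
    (h : (kernelMatrix p q (sparseGrid d τ ∪ A) (sparseGrid d τ ∪ A))⁻¹ y z ≠ 0) :
    y.1 ∈ stencil z.1 := by
  rw [hA.inv_apply hTM y z hz] at h
  exact hA.isHierarchical.mem_stencil_of_coef_ne_zero y.2 h

theorem inv_apply_self (hTM : IsTMPair p q) {l i : Fin d → ℕ} (h : IsIndex l i)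
    (hz : gridPoint l i ∈ A) (hz' : gridPoint l i ∈ sparseGrid d τ ∪ A) :
    (kernelMatrix p q (sparseGrid d τ ∪ A) (sparseGrid d τ ∪ A))⁻¹
        ⟨gridPoint l i, hz'⟩ ⟨gridPoint l i, hz'⟩ =
      ∏ j, nodeRatio (p j) (q j) (l j) (i j) := by
  rw [hA.inv_apply hTM _ _ hz, level_gridPoint h, index_gridPoint h, coef_gridPoint]

/-- Vanishing entries of the inverse kernel matrix. -/
theorem inv_eq_zero (hTM : IsTMPair p q) {l' i' l'' i'' : Fin d → ℕ} (hi' : IsIndex l' i')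
    (hi'' : IsIndex l'' i'') (h' : gridPoint l' i' ∈ sparseGrid d τ ∪ A)
    (h'' : gridPoint l'' i'' ∈ sparseGrid d τ ∪ A)
    (h : (gridPoint l' i' ∈ A ∧ gridPoint l'' i'' ∈ A ∧ gridPoint l' i' ≠ gridPoint l'' i'') ∨
      (gridPoint l'' i'' ∈ A ∧ gridPoint l'' i'' ∉ hyperrect l' i') ∨
      ∃ j, 2 ≤ |(i' j : ℤ) * 2 ^ (max (l' j) (l'' j) - l' j) -
        (i'' j : ℤ) * 2 ^ (max (l' j) (l'' j) - l'' j)|) :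
    (kernelMatrix p q (sparseGrid d τ ∪ A) (sparseGrid d τ ∪ A))⁻¹
      ⟨gridPoint l' i', h'⟩ ⟨gridPoint l'' i'', h''⟩ = 0 := by
  by_contra hne
  rcases h with ⟨ha', ha'', hd⟩ | ⟨ha'', hr⟩ | ⟨j, hj⟩
  · have := hA.mem_stencil_of_inv_ne_zero hTM ha'' hne
    exact hd (hA.eq_of_mem_stencil h'' ha' this).symm
  · have := hA.mem_stencil_of_inv_ne_zero hTM ha'' hne
    refine hr fun j => node_mem_Ioo_of_mem_nbr (hi' j).1 (hi'' j).1 ?_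
    have hj : node (l' j) (i' j) ∈ nbr _ _ := mem_nbrs.1 this j
    simpa only [level_gridPoint hi'', index_gridPoint hi''] using hj
  · obtain ⟨x, hx, hx', hx''⟩ := hA.isHierarchical.exists_mem_stencil hTM hne
    exact not_mem_stencil_of_separated (hA.isHierarchical.isIndex hx) hi' hi'' hj hx' hx''

end IsTSG

/-! ### Counting nonzero entries -/

theorem nnz_le_card {α : Type*} {S T : Finset α} (M : Matrix S T ℝ) (U : Finset (α × α))
    (h : ∀ y z, M y z ≠ 0 → (y.1, z.1) ∈ U) : nnz M ≤ U.card := by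
  refine Finset.card_le_card_of_injOn (fun yz => (yz.1.1, yz.2.1)) ?_ ?_
  · intro yz hyz
    exact h _ _ (Finset.mem_filter.1 hyz).2
  · rintro ⟨y, z⟩ _ ⟨y', z'⟩ _ he
    simp only [Prod.mk.injEq] at he
    exact Prod.ext (Subtype.ext he.1) (Subtype.ext he.2)

/-- A matrix whose nonzero entries belong to pairs of points in a common stencil is sparse. -/
theorem nnz_le_of_exists_mem_stencil {S T X : Finset (Fin d → ℝ)} (M : Matrix S T ℝ)
    (h : ∀ y z, M y z ≠ 0 → ∃ x ∈ X, y.1 ∈ stencil x ∧ z.1 ∈ stencil x) :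
    nnz M ≤ X.card * 9 ^ d := by
  refine (nnz_le_card M (X.biUnion fun x => stencil x ×ˢ stencil x) fun y z hne => ?_).trans
    (Finset.card_biUnion_le_card_mul _ _ _ fun x _ => ?_)
  · obtain ⟨x, hx, h1, h2⟩ := h y z hne
    exact Finset.mem_biUnion.2 ⟨x, hx, Finset.mem_product.2 ⟨h1, h2⟩⟩
  · rw [Finset.card_product, show 9 = 3 * 3 from rfl, mul_pow]
    exact Nat.mul_le_mul (card_stencil_le x) (card_stencil_le x)

theorem nnz_le_of_mem_stencil {S T : Finset (Fin d → ℝ)} (M : Matrix S T ℝ)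
    (h : ∀ y z, M y z ≠ 0 → y.1 ∈ stencil z.1) : nnz M ≤ T.card * 3 ^ d := by
  refine (nnz_le_card M (T.biUnion fun z => stencil z ×ˢ {z}) fun y z hne => ?_).trans
    (Finset.card_biUnion_le_card_mul _ _ _ fun z _ => ?_)
  · exact Finset.mem_biUnion.2
      ⟨z, z.2, Finset.mem_product.2 ⟨h y z hne, Finset.mem_singleton_self _⟩⟩
  · rw [Finset.card_product, Finset.card_singleton, mul_one]
    exact card_stencil_le z

/-! ### Block inverse -/

/-- The first block row of the product determines the upper blocks of M from its lower right block,
because `a` is invertible; symmetry supplies the lower left block. -/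
theorem eq_fromBlocks_of_fromBlocks_mul_eq_one {m n R : Type*} [Fintype m] [Fintype n]
    [DecidableEq m] [DecidableEq n] [CommRing R] {a : Matrix m m R} {b : Matrix m n R}
    {c : Matrix n n R} {M : Matrix (m ⊕ n) (m ⊕ n) R} (ha : IsUnit a.det) (hM : M.IsSymm)
    (h : Matrix.fromBlocks a b b.transpose c * M = 1) :
    M = Matrix.fromBlocks (a⁻¹ + a⁻¹ * b * M.toBlocks₂₂ * (a⁻¹ * b).transpose)
      (-(a⁻¹ * b * M.toBlocks₂₂)) (-(M.toBlocks₂₂ * (a⁻¹ * b).transpose)) M.toBlocks₂₂ := by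
  obtain ⟨e, f, g, D, rfl⟩ : ∃ e f g D, M = Matrix.fromBlocks e f g D :=
    ⟨_, _, _, _, (Matrix.fromBlocks_toBlocks M).symm⟩
  rw [Matrix.IsSymm, Matrix.fromBlocks_transpose, Matrix.fromBlocks_inj] at hM
  obtain ⟨-, -, hg, hD⟩ := hM
  rw [Matrix.fromBlocks_multiply, ← Matrix.fromBlocks_one, Matrix.fromBlocks_inj] at h
  obtain ⟨h1, h2, -, -⟩ := h
  have hf : f = -(a⁻¹ * b * D) := by
    have := congrArg (a⁻¹ * ·) h2
    simp only [Matrix.mul_add, Matrix.nonsing_inv_mul_cancel_left _ _ ha, Matrix.mul_zero,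
      ← Matrix.mul_assoc] at this
    exact eq_neg_of_add_eq_zero_left this
  have hg' : g = -(D * (a⁻¹ * b).transpose) := by
    rw [← hg, hf, Matrix.transpose_neg, Matrix.transpose_mul, hD]
  have he : e = a⁻¹ + a⁻¹ * b * D * (a⁻¹ * b).transpose := by
    have := congrArg (a⁻¹ * ·) h1
    simp only [Matrix.mul_add, Matrix.nonsing_inv_mul_cancel_left _ _ ha, Matrix.mul_one,
      ← Matrix.mul_assoc] at this
    rw [eq_sub_of_add_eq this, hg', Matrix.mul_neg, sub_neg_eq_add, ← Matrix.mul_assoc]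
  rw [Matrix.toBlocks_fromBlocks₂₂, ← he, ← hf, ← hg']

/-- The block form of the inverse kernel matrix of a union of two designs. -/
theorem submatrix_inv_kernelMatrix_union {S A : Finset (Fin d → ℝ)} (hSA : Disjoint S A)
    (hS : IsUnit (kernelMatrix p q S S).det)
    (hX : IsUnit (kernelMatrix p q (S ∪ A) (S ∪ A)).det) :
    let M := (kernelMatrix p q (S ∪ A) (S ∪ A))⁻¹.submatrix (Equiv.Finset.union S A hSA)
      (Equiv.Finset.union S A hSA)
    let B := (kernelMatrix p q S S)⁻¹ * kernelMatrix p q S A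
    M = Matrix.fromBlocks ((kernelMatrix p q S S)⁻¹ + B * M.toBlocks₂₂ * B.transpose)
      (-(B * M.toBlocks₂₂)) (-(M.toBlocks₂₂ * B.transpose)) M.toBlocks₂₂ := by
  intro M B
  refine eq_fromBlocks_of_fromBlocks_mul_eq_one (c := kernelMatrix p q A A) hS ?_ ?_
  · ext x y
    exact inv_kernelMatrix_comm _ _
  · have : Matrix.fromBlocks (kernelMatrix p q S S) (kernelMatrix p q S A)
        (kernelMatrix p q S A).transpose (kernelMatrix p q A A) =
        (kernelMatrix p q (S ∪ A) (S ∪ A)).submatrix (Equiv.Finset.union S A hSA)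
          (Equiv.Finset.union S A hSA) := by
      rw [kernelMatrix_transpose]
      ext x y
      rcases x with x | x <;> rcases y with y | y <;> rfl
    rw [this, Matrix.submatrix_mul_equiv, Matrix.mul_nonsing_inv _ hX, Matrix.submatrix_one_equiv]

theorem one_le_log_of_three_le {x : ℝ} (hx : 3 ≤ x) : 1 ≤ Real.log x := by
  rw [Real.le_log_iff_exp_le (by linarith)]
  linarith [Real.exp_one_lt_d9]

end TruncatedSparseGrid

/-! ### Assembly of the three claims -/

theorem theorem5 {d : ℕ} (hd : 1 ≤ d) (p q : Fin d → ℝ → ℝ)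
    (hTM : IsTMPair p q) (hSL : SatisfiesSL p q) :
    ∃ C : ℝ, ∀ (n τ : ℕ) (A : Finset (Fin d → ℝ)) (hA : IsTSG n τ A), 3 ≤ n →
      let S := sparseGrid d τ
      let K := kernelMatrix p q (S ∪ A) (S ∪ A)
      let KS := kernelMatrix p q S S
      let B := KS⁻¹ * kernelMatrix p q S A
      ∃ D : Matrix A A ℝ,
        let E := KS⁻¹ + B * D * B.transpose
        -- (i) block form of the inverse
        (IsUnit K.det ∧ IsUnit KS.det ∧ D.IsDiag ∧
          (∀ (l i : Fin d → ℕ) (_ : IsIndex l i) (h : gridPoint l i ∈ A),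
            D ⟨gridPoint l i, h⟩ ⟨gridPoint l i, h⟩ =
                ∏ j, nodeRatio (p j) (q j) (l j) (i j) ∧
              ∀ (H : Type*) [NormedAddCommGroup H] [InnerProductSpace ℝ H] [CompleteSpace H]
                [RKHS ℝ H (UnitCube d) ℝ], HasTMKernel p q H →
                ∃ φ : H, (∀ x : UnitCube d, φ x = basisFun p q l i x.1) ∧
                  D ⟨gridPoint l i, h⟩ ⟨gridPoint l i, h⟩ = ‖φ‖ ^ 2) ∧
          (K⁻¹).submatrix (Equiv.Finset.union S A hA.disjoint)
              (Equiv.Finset.union S A hA.disjoint) =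
            Matrix.fromBlocks E (-(B * D)) (-(D * B.transpose)) D) ∧
        -- (ii) vanishing entries
        (∀ (l' i' l'' i'' : Fin d → ℕ) (_ : IsIndex l' i') (_ : IsIndex l'' i'')
          (h' : gridPoint l' i' ∈ S ∪ A) (h'' : gridPoint l'' i'' ∈ S ∪ A),
          ((gridPoint l' i' ∈ A ∧ gridPoint l'' i'' ∈ A ∧ gridPoint l' i' ≠ gridPoint l'' i'') ∨
            (gridPoint l' i' ∈ S ∧ gridPoint l'' i'' ∈ A ∧
              gridPoint l'' i'' ∉ hyperrect l' i') ∨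
            (gridPoint l' i' ∈ S ∧ gridPoint l'' i'' ∈ S ∧
              (∃ j, 2 ≤ |(i' j : ℤ) * 2 ^ (max (l' j) (l'' j) - l' j) -
                (i'' j : ℤ) * 2 ^ (max (l' j) (l'' j) - l'' j)|) ∧
              ∀ x ∈ A, x ∉ hyperrect l' i' ∩ hyperrect l'' i'')) →
          K⁻¹ ⟨gridPoint l' i', h'⟩ ⟨gridPoint l'' i'', h''⟩ = 0 ∧
            K⁻¹ ⟨gridPoint l'' i'', h''⟩ ⟨gridPoint l' i', h'⟩ = 0) ∧
        -- (iii) sparsity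
        ((nnz E : ℝ) ≤ C * ((S.card : ℝ) + (A.card : ℝ) * (τ : ℝ) ^ (2 * d)) ∧
          (2 ≤ τ →
            (nnz (B * D) : ℝ) ≤ C * ((A.card : ℝ) * Real.log (S.card : ℝ) ^ (d - 1))) ∧
          density K⁻¹ ≤ C * ((n : ℝ)⁻¹ * Real.log (n : ℝ) ^ (2 * d))) := by

  -- The constant counts the pairs of points in one stencil, (3^d)².
  refine ⟨9 ^ d, fun n τ A hA hn => ?_⟩
  intro S K KS B
  have hS := isHierarchical_sparseGrid d τ
  have hX := hA.isHierarchical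
  have block := submatrix_inv_kernelMatrix_union hA.disjoint (hS.isUnit_det hTM)
    (hX.isUnit_det hTM)
  let e := Equiv.Finset.union S A hA.disjoint
  -- Taking D as the block of K⁻¹ itself makes the block formula pure elimination; its diagonal form
  -- follows from the stencils.
  let D : Matrix A A ℝ := ((K⁻¹).submatrix e e).toBlocks₂₂
  refine ⟨D, ?_⟩
  intro E
  replace block : (K⁻¹).submatrix e e =
    Matrix.fromBlocks E (-(B * D)) (-(D * B.transpose)) D := block
  have hE : ∀ y z : S, K⁻¹ ⟨y, Finset.mem_union_left _ y.2⟩ ⟨z, Finset.mem_union_left _ z.2⟩ =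
      E y z := by
    intro y z
    have := congrFun (congrFun block (Sum.inl y)) (Sum.inl z)
    rwa [Matrix.submatrix_apply, Equiv.Finset.union_inl, Equiv.Finset.union_inl,
      Matrix.fromBlocks_apply₁₁] at this
  have hBD : ∀ (y : S) (z : A), K⁻¹ ⟨y, Finset.mem_union_left _ y.2⟩
      ⟨z, Finset.mem_union_right _ z.2⟩ = (-(B * D)) y z := by
    intro y z
    have := congrFun (congrFun block (Sum.inl y)) (Sum.inr z)
    rwa [Matrix.submatrix_apply, Equiv.Finset.union_inl, Equiv.Finset.union_inr,
      Matrix.fromBlocks_apply₁₂] at this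
  have hcardX : (S ∪ A).card = n := by
    rw [Finset.card_union_of_disjoint hA.disjoint]
    exact hA.card_add
  refine ⟨⟨hX.isUnit_det hTM, hS.isUnit_det hTM, ?_, fun l i hli h => ?_, block⟩, ?_, ?_, ?_, ?_⟩
  · intro y z hyz
    by_contra hne
    have hmem := hA.mem_stencil_of_inv_ne_zero hTM z.2 hne
    exact hyz (Subtype.ext
      (hA.eq_of_mem_stencil (Finset.mem_union_right _ z.2) y.2 hmem).symm)
  · have hD : D ⟨gridPoint l i, h⟩ ⟨gridPoint l i, h⟩ =
        ∏ j, nodeRatio (p j) (q j) (l j) (i j) :=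
      hA.inv_apply_self hTM hli h (Finset.mem_union_right _ h)
    refine ⟨hD, fun H _ _ _ _ hH => ?_⟩
    rw [hD]
    exact hTM.exists_basisFun_mem hli H hH
  · intro l' i' l'' i'' hi' hi'' h' h'' h
    have key := hA.inv_eq_zero hTM hi' hi'' h' h'' (by
      rcases h with h | ⟨-, h⟩ | ⟨-, -, h, -⟩
      exacts [Or.inl h, Or.inr (Or.inl h), Or.inr (Or.inr h)])
    exact ⟨key, (inv_kernelMatrix_comm _ _).trans key⟩
  · have h1 : nnz E ≤ (S ∪ A).card * 9 ^ d := by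
      refine nnz_le_of_exists_mem_stencil E fun y z hne => ?_
      rw [← hE] at hne
      exact hX.exists_mem_stencil hTM hne
    rw [Finset.card_union_of_disjoint hA.disjoint] at h1
    have h2 : (nnz E : ℝ) ≤ ((S.card : ℝ) + A.card) * 9 ^ d := by exact_mod_cast h1
    refine h2.trans ?_
    rw [mul_comm]
    have hτ : (1 : ℝ) ≤ (τ : ℝ) ^ (2 * d) := one_le_pow₀ (by exact_mod_cast hA.one_le_level)
    gcongr
    exact le_mul_of_one_le_right (Nat.cast_nonneg _) hτ
  · intro hτ
    have h1 : nnz (B * D) ≤ A.card * 3 ^ d := by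
      refine nnz_le_of_mem_stencil _ fun y z hne => ?_
      -- Up to sign, B D is the part of the columns of K⁻¹ at points of A, each supported on one
      -- stencil.
      rw [← neg_ne_zero, ← Matrix.neg_apply, ← hBD] at hne
      exact hA.mem_stencil_of_inv_ne_zero (z := ⟨z, Finset.mem_union_right _ z.2⟩) hTM z.2 hne
    have h2 : (nnz (B * D) : ℝ) ≤ A.card * 3 ^ d := by exact_mod_cast h1
    have hlog : (1 : ℝ) ≤ Real.log S.card ^ (d - 1) :=
      one_le_pow₀ (one_le_log_of_three_le (by exact_mod_cast three_le_card_sparseGrid hd hτ))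
    refine h2.trans ?_
    rw [mul_comm]
    exact mul_le_mul (pow_le_pow_left₀ (by norm_num) (by norm_num) d)
      (le_mul_of_one_le_right (Nat.cast_nonneg _) hlog) (Nat.cast_nonneg _) (by positivity)
  · have h1 : nnz K⁻¹ ≤ (S ∪ A).card * 9 ^ d :=
      nnz_le_of_exists_mem_stencil _ fun y z hne => hX.exists_mem_stencil hTM hne
    rw [hcardX] at h1
    have h2 : (nnz K⁻¹ : ℝ) ≤ n * 9 ^ d := by exact_mod_cast h1
    have hlog : (1 : ℝ) ≤ Real.log n ^ (2 * d) :=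
      one_le_pow₀ (one_le_log_of_three_le (by exact_mod_cast hn))
    have hn0 : (0 : ℝ) < n := by exact_mod_cast (by omega : 0 < n)
    unfold density
    rw [Fintype.card_coe, hcardX]
    calc (nnz K⁻¹ : ℝ) / (n * n) ≤ n * 9 ^ d / (n * n) := by gcongr
      _ = 9 ^ d * ((n : ℝ)⁻¹ * 1) := by field_simp
      _ ≤ _ := by gcongr
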